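/- Let $\mathbb D$ be the open unit disc and $\mathbb T$ the unit circle. Let $\Theta$ be an inner function, that is, a bounded analytic function in $\mathbb D$ with $|\Theta|=1$ almost everywhere on $\mathbb T$ in the sense of nontangential boundary values. Let $\mu$ be a (nonnegative) Borel measure on $\overline{\mathbb D}$. Let $\sigma(\Theta)$ be the spectrum of $\Theta$, i.e. the set of all $\zeta\in\overline{\mathbb D}$ with $\liminf_{z\to\zeta,\,z\in\mathbb D}|\Theta(z)|=0$. For a nondegenerate arc $I\subset\mathbb T$ of length $|I|$ put $$S(I)=\{\rho e^{i\varphi}\in\overline{\mathbb D}:\ e^{i\varphi}\in I,\ 1-(2\pi)^{-1}|I|\le\rho\le 1\},$$ and for a Borel measure $\nu$ on $\overline{\mathbb D}$ let $M_\nu\in[0,\infty]$ be the smallest $M$ such that $\nu(S(I))\le M|I|$ for all arcs $I\subset\mathbb T$. For $\delta>0$ let $H_\delta=\{z\in\overline{\mathbb D}:\ \mathrm{dist}(z,\sigma(\Theta)\cap\mathbb T)<\delta\}$ (with $H_\delta=\emptyset$ if $\sigma(\Theta)\cap\mathbb T=\emptyset$), and let $\mu_\delta=\mu|_{H_\delta}$.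 **Proposition 4.1.** Suppose that $\mu$ satisfies the first vanishing condition (V1): $$M_{\mu_\delta}\to 0\quad\text{as }\delta\to 0^+.$$ Then $\mu$ satisfies the second vanishing condition (V2): for every $\varepsilon\in(0,1)$ and every $\eta>0$ there exists $\delta>0$ such that $\mu(S(I))/|I|<\eta$ for every arc $I\subset\mathbb T$ with $|I|<\delta$ and $S(I)\cap\{z\in\mathbb D:\ |\Theta(z)|<\varepsilon\}\ne\emptyset$. -/

import Mathlib

noncomputable section

namespace VanishingCarleson

open Filter Topology MeasureTheory Set

/-- The open unit disc. -/
def disc : Set ℂ := Metric.ball 0 1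

/-- The closed unit disc. -/
def closedDisc : Set ℂ := Metric.closedBall 0 1

/-- The unit circle. -/
def circle : Set ℂ := Metric.sphere 0 1

/-- The point of the unit circle with argument `t`. -/
def cis (t : ℝ) : ℂ := Complex.exp (t * Complex.I)

/-- The Stolz (nontangential approach) region of aperture `α` at the boundary point `ζ`. -/
def stolz (α : ℝ) (ζ : ℂ) : Set ℂ := {z ∈ disc | ‖ζ - z‖ < α * (1 - ‖z‖)}

/-- `w` is the nontangential boundary value of `Θ` at `ζ`: the limit of `Θ` at `ζ` within
every Stolz region with vertex `ζ`. (For `α ≤ 1` the region is empty, which is harmless.) -/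
def HasNontangentialLimit (Θ : ℂ → ℂ) (ζ w : ℂ) : Prop :=
  ∀ α : ℝ, Tendsto Θ (𝓝[stolz α ζ] ζ) (𝓝 w)

/-- Inner functions: analytic and bounded in the unit disc, with unimodular nontangential
boundary values at almost every point of the circle. Almost everywhere with respect to
normalized arc length is the same as for Lebesgue almost every argument. The values of `Θ`
outside the open disc play no role. -/
structure IsInner (Θ : ℂ → ℂ) : Prop where
  analytic : AnalyticOnNhd ℂ Θ disc
  bounded : ∃ C : ℝ, ∀ z ∈ disc, ‖Θ z‖ ≤ C
  unimodular : ∀ᵐ t : ℝ, ∃ w : ℂ, ‖w‖ = 1 ∧ HasNontangentialLimit Θ (cis t) w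

/-- The spectrum of `Θ`: the points `ζ` of the closed disc with
`liminf |Θ(z)| = 0` as `z → ζ`, `z` in the open disc. -/
def spectrum (Θ : ℂ → ℂ) : Set ℂ :=
  {ζ ∈ closedDisc | liminf (fun z => ‖Θ z‖ₑ) (𝓝[disc] ζ) = 0}

/-- The level set `{z : |z| < 1, |Θ(z)| < ε}`. -/
def levelSet (Θ : ℂ → ℂ) (ε : ℝ) : Set ℂ := {z ∈ disc | ‖Θ z‖ < ε}

/-- A nondegenerate arc of the unit circle: the set of points whose argument runs through
an interval with endpoints `left < right ≤ left + 2π`; each endpoint may or may not belong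
to the interval. The whole circle is included. -/
structure Arc where
  left : ℝ
  right : ℝ
  left_lt_right : left < right
  right_le : right ≤ left + 2 * Real.pi
  angles : Set ℝ
  Ioo_subset : Ioo left right ⊆ angles
  subset_Icc : angles ⊆ Icc left right

/-- The arc as a subset of the circle. -/
def Arc.toSet (I : Arc) : Set ℂ := cis '' I.angles

/-- The (unnormalized) length of the arc. -/
def Arc.length (I : Arc) : ℝ := I.right - I.left

/-- The Carleson square over the arc `I`:
all `ρ e^{iφ}` with `e^{iφ} ∈ I` and `1 - |I| / (2π) ≤ ρ ≤ 1`. -/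
def Arc.square (I : Arc) : Set ℂ :=
  {z | ∃ ρ : ℝ, ∃ φ : ℝ, z = ρ * cis φ ∧ cis φ ∈ I.toSet ∧
    1 - I.length / (2 * Real.pi) ≤ ρ ∧ ρ ≤ 1}

/-- The Carleson constant of `ν`: the least `M` with `ν (S(I)) ≤ M |I|` for all arcs `I`;
it is `∞` if there is no finite such `M`. -/
def carlesonConstant (ν : Measure ℂ) : ENNReal :=
  sInf {M : ENNReal | ∀ I : Arc, ν I.square ≤ M * ENNReal.ofReal I.length}

/-- The points of the closed disc at distance less than `δ` from the boundary spectrum of `Θ`;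
it is empty if the boundary spectrum is empty. -/
def boundaryNhd (Θ : ℂ → ℂ) (δ : ℝ) : Set ℂ :=
  closedDisc ∩ Metric.thickening δ (spectrum Θ ∩ circle)

/-- First vanishing condition: the Carleson constants of the restrictions of `μ` to the
`δ`-neighbourhoods of the boundary spectrum tend to `0` as `δ → 0+`. -/
def V1 (Θ : ℂ → ℂ) (μ : Measure ℂ) : Prop :=
  Tendsto (fun δ : ℝ => carlesonConstant (μ.restrict (boundaryNhd Θ δ))) (𝓝[>] 0) (𝓝 0)

/-- Second vanishing condition at level `ε`: `μ (S(I)) / |I|` is small, uniformly over the short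
arcs `I` whose Carleson square meets the level set `{|Θ| < ε}`. -/
def V2 (Θ : ℂ → ℂ) (μ : Measure ℂ) (ε : ℝ) : Prop :=
  ∀ η : ℝ, 0 < η → ∃ δ : ℝ, 0 < δ ∧ ∀ I : Arc, I.length < δ →
    (I.square ∩ levelSet Θ ε).Nonempty →
      μ I.square / ENNReal.ofReal I.length < ENNReal.ofReal η

end VanishingCarleson

end

/-! At a point ζ of the circle outside the spectrum, |Θ(z)| → 1 for unrestricted z → ζ
(`IsInner.tendsto_norm`). By compactness, {|Θ| < ε} keeps a positive distance from the part of the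
circle far from the boundary spectrum. A short Carleson square meeting {|Θ| < ε} therefore lies
entirely in `boundaryNhd Θ δ₀`, where μ and its restriction agree, and (V1) bounds its mass.

For the limit, pull Θ back to G on the upper half plane by w ↦ cis t · exp(iw). Near 0, |G| is
bounded above and, since the liminf is positive, bounded away from zero. Extend G to F by 1 / conj
G(conj z) below the axis: F is bounded, holomorphic off the axis, and continuous across it on almost
every vertical line. The averages h⁻¹ ∫₀ʰ F(z + t) dt are continuous by dominated convergence, hence
holomorphic across the axis by Morera, and bounded independently of h. Cauchy's estimate makes them
uniformly Lipschitz, and h → 0 passes this to F off the axis. Comparing F at z and conj z gives |G -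
1 / conj G| = O(Im z), so |G| → 1. -/

noncomputable section

namespace VanishingCarleson

open Filter Topology MeasureTheory Set

/-! ### Morera's theorem across a line and a Cauchy estimate -/

/-- A continuous function that is holomorphic off the real axis has vanishing integrals over
rectangles. -/
theorem isConservativeOn_of_differentiableAt_off_real {f : ℂ → ℂ} {U : Set ℂ}
    (hc : ContinuousOn f U) (hd : ∀ z ∈ U, z.im ≠ 0 → DifferentiableAt ℂ f z) :
    Complex.IsConservativeOn f U := by
  have key : ∀ z w : ℂ, Complex.Rectangle z w ⊆ U →
      (0 : ℝ) ∉ Ioo (min z.im w.im) (max z.im w.im) →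
      (∫ x : ℝ in z.re..w.re, f (x + z.im * Complex.I)) -
        (∫ x : ℝ in z.re..w.re, f (x + w.im * Complex.I)) +
        Complex.I • (∫ y : ℝ in z.im..w.im, f (w.re + y * Complex.I)) -
        Complex.I • (∫ y : ℝ in z.im..w.im, f (z.re + y * Complex.I)) = 0 := by
    intro z w hzw h0
    refine Complex.integral_boundary_rect_eq_zero_of_continuousOn_of_differentiableOn f z w
      (hc.mono hzw) fun u hu => (hd u (hzw ?_) ?_).differentiableWithinAt
    · exact ⟨Ioo_subset_Icc_self hu.1, Ioo_subset_Icc_self hu.2⟩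
    · intro hu0
      exact h0 (hu0 ▸ hu.2)
  intro z w hzw
  rw [← add_eq_zero_iff_eq_neg, Complex.wedgeIntegral_add_wedgeIntegral_eq]
  -- A rectangle crossing the axis is cut along it: each half has its interior off the axis, and the
  -- two integrals over the cut cancel.
  by_cases h0 : (0 : ℝ) ∈ Ioo (min z.im w.im) (max z.im w.im)
  swap
  · exact key z w hzw h0
  have hmem : (0 : ℝ) ∈ uIcc z.im w.im := Ioo_subset_Icc_self h0
  have h1 := key z ⟨w.re, 0⟩
    (fun u hu => hzw ⟨hu.1, uIcc_subset_uIcc left_mem_uIcc hmem hu.2⟩) (by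
      intro h; rcases le_total z.im 0 with h' | h' <;> simp_all)
  have h2 := key ⟨z.re, 0⟩ w
    (fun u hu => hzw ⟨hu.1, uIcc_subset_uIcc hmem right_mem_uIcc hu.2⟩) (by
      intro h; rcases le_total w.im 0 with h' | h' <;> simp_all)
  have hint : ∀ a ∈ uIcc z.re w.re, ∀ p ∈ uIcc z.im w.im, ∀ q ∈ uIcc z.im w.im,
      IntervalIntegrable (fun y : ℝ => f (a + y * Complex.I)) volume p q := by
    intro a ha p hp q hq
    refine ContinuousOn.intervalIntegrable (hc.comp (by fun_prop) fun y hy => hzw ?_)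
    refine ⟨by simpa using ha, ?_⟩
    simpa using uIcc_subset_uIcc hp hq hy
  have h3 := intervalIntegral.integral_add_adjacent_intervals
    (hint _ left_mem_uIcc _ left_mem_uIcc _ hmem) (hint _ left_mem_uIcc _ hmem _ right_mem_uIcc)
  have h4 := intervalIntegral.integral_add_adjacent_intervals
    (hint _ right_mem_uIcc _ left_mem_uIcc _ hmem) (hint _ right_mem_uIcc _ hmem _ right_mem_uIcc)
  rw [← h3, ← h4]
  simp only [smul_eq_mul] at h1 h2 ⊢
  linear_combination h1 + h2

/-- A continuous function on a disc that is holomorphic off the real axis is holomorphic. -/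
theorem differentiableOn_ball_of_differentiableAt_off_real {f : ℂ → ℂ} {c : ℂ} {r : ℝ}
    (hc : ContinuousOn f (Metric.ball c r))
    (hd : ∀ z ∈ Metric.ball c r, z.im ≠ 0 → DifferentiableAt ℂ f z) :
    DifferentiableOn ℂ f (Metric.ball c r) :=
  ((isConservativeOn_of_differentiableAt_off_real hc hd).isExactOn_ball hc).differentiableOn
    Metric.isOpen_ball

/-- A holomorphic function bounded by `K` on a disc of radius `R` is Lipschitz on the concentric
disc of half the radius. -/
theorem norm_sub_le_of_bounded_ball {f : ℂ → ℂ} {R K : ℝ} (hR : 0 < R)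
    (hd : DifferentiableOn ℂ f (Metric.ball 0 R)) (hb : ∀ z ∈ Metric.ball (0 : ℂ) R, ‖f z‖ ≤ K)
    {z w : ℂ} (hz : z ∈ Metric.ball (0 : ℂ) (R / 2)) (hw : w ∈ Metric.ball (0 : ℂ) (R / 2)) :
    ‖f z - f w‖ ≤ K / (R / 4) * ‖z - w‖ := by
  refine (convex_ball (0 : ℂ) (R / 2)).norm_image_sub_le_of_norm_deriv_le
    (fun x hx => hd.differentiableAt (Metric.isOpen_ball.mem_nhds
      (Metric.ball_subset_ball (by linarith) hx))) (fun x hx => ?_) hw hz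
  have hsub : Metric.closedBall x (R / 4) ⊆ Metric.ball 0 R := by
    intro u hu
    rw [Metric.mem_ball, Metric.mem_closedBall] at *
    linarith [dist_triangle u x 0]
  refine Complex.norm_deriv_le_of_forall_mem_sphere_norm_le (by positivity) ?_
    fun u hu => hb u (hsub (Metric.sphere_subset_closedBall hu))
  exact (hd.mono (Metric.closure_ball_subset_closedBall.trans hsub)).diffContOnCl

/-! ### Horizontal averages of a function glued along the real axis -/

/-- `F` is bounded by `K` on the disc of radius `R` about `0`, holomorphic there off the real axis,
and on almost every vertical line it is continuous at the real axis. -/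
structure IsGluedAlongReal (F : ℂ → ℂ) (R K : ℝ) : Prop where
  differentiableAt : ∀ z ∈ Metric.ball (0 : ℂ) R, z.im ≠ 0 → DifferentiableAt ℂ F z
  norm_le : ∀ z ∈ Metric.ball (0 : ℂ) R, ‖F z‖ ≤ K
  tendsto : ∀ᵐ x : ℝ, (x : ℂ) ∈ Metric.ball (0 : ℂ) R →
    Tendsto (fun y : ℝ => F (x + y * Complex.I)) (𝓝[≠] 0) (𝓝 (F x))

/-- The integral of `F` over the horizontal segment from `z` to `z + h`. -/
def horizontalIntegral (F : ℂ → ℂ) (h : ℝ) (z : ℂ) : ℂ :=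
  ∫ t in z.re..(z.re + h), F (t + z.im * Complex.I)

/-- Moving endpoints suit the proof of continuity; fixed endpoints allow complex differentiation
under the integral sign. -/
theorem horizontalIntegral_eq (F : ℂ → ℂ) (h : ℝ) (z : ℂ) :
    horizontalIntegral F h z = ∫ t in (0 : ℝ)..h, F (z + t) := by
  have := intervalIntegral.integral_comp_add_left
    (f := fun t : ℝ => F (t + z.im * Complex.I)) (a := 0) (b := h) z.re
  rw [horizontalIntegral, ← add_zero z.re, add_assoc, zero_add, ← this]
  congr 1
  ext t
  congr 1
  apply Complex.ext <;> simp

namespace IsGluedAlongReal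

variable {F : ℂ → ℂ} {R K : ℝ}

/-- Treats heights on and off the axis alike; this is the pointwise convergence fed to dominated
convergence. -/
theorem ae_continuousAt (hF : IsGluedAlongReal F R K) (y₀ : ℝ) :
    ∀ᵐ x : ℝ, (x + y₀ * Complex.I : ℂ) ∈ Metric.ball (0 : ℂ) R →
      Tendsto (fun y : ℝ => F (x + y * Complex.I)) (𝓝 y₀) (𝓝 (F (x + y₀ * Complex.I))) := by
  rcases eq_or_ne y₀ 0 with rfl | hy
  · filter_upwards [hF.tendsto] with x hx hx0
    have : ContinuousAt (fun y : ℝ => F (x + y * Complex.I)) 0 := by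
      rw [continuousAt_iff_punctured_nhds]
      simpa using hx (by simpa using hx0)
    exact this
  · refine Eventually.of_forall fun x hx => ?_
    have h1 : ContinuousAt F (x + y₀ * Complex.I) :=
      (hF.differentiableAt _ hx (by simpa using hy)).continuousAt
    exact h1.tendsto.comp (Continuous.tendsto (by fun_prop) y₀)

theorem continuousOn_line (hF : IsGluedAlongReal F R K) {y : ℝ} (hy : y ≠ 0) :
    ContinuousOn (fun t : ℝ => F (t + y * Complex.I))
      {t : ℝ | (t + y * Complex.I : ℂ) ∈ Metric.ball (0 : ℂ) R} := by
  intro t ht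
  have h1 : ContinuousAt F (t + y * Complex.I) :=
    (hF.differentiableAt _ ht (by simpa using hy)).continuousAt
  exact (ContinuousAt.comp (f := fun t : ℝ => (t + y * Complex.I : ℂ)) h1
    (Continuous.continuousAt (by fun_prop))).continuousWithinAt

theorem isOpen_line (y R : ℝ) :
    IsOpen {t : ℝ | (t + y * Complex.I : ℂ) ∈ Metric.ball (0 : ℂ) R} :=
  Metric.isOpen_ball.preimage (by fun_prop)

theorem aestronglyMeasurable_line_of_ne (hF : IsGluedAlongReal F R K) {y : ℝ} (hy : y ≠ 0)
    {s : Set ℝ} (hs : ∀ t ∈ s, (t + y * Complex.I : ℂ) ∈ Metric.ball (0 : ℂ) R) :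
    AEStronglyMeasurable (fun t : ℝ => F (t + y * Complex.I)) (volume.restrict s) :=
  ((hF.continuousOn_line hy).aestronglyMeasurable
    (isOpen_line y R).measurableSet).mono_measure (Measure.restrict_mono hs le_rfl)

theorem eventually_uIcc_mem {a b y₀ : ℝ}
    (hs : ∀ t ∈ uIcc a b, (t + y₀ * Complex.I : ℂ) ∈ Metric.ball (0 : ℂ) R) :
    ∀ᶠ y : ℝ in 𝓝 y₀, ∀ t ∈ uIcc a b, (t + y * Complex.I : ℂ) ∈ Metric.ball (0 : ℂ) R := by
  refine isCompact_uIcc.eventually_forall_of_forall_eventually fun t ht => ?_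
  have h : Continuous fun p : ℝ × ℝ => (p.2 + p.1 * Complex.I : ℂ) := by fun_prop
  exact h.continuousAt.eventually (Metric.isOpen_ball.mem_nhds (hs t ht))

theorem aestronglyMeasurable_line (hF : IsGluedAlongReal F R K) {a b y : ℝ}
    (hs : ∀ t ∈ uIcc a b, (t + y * Complex.I : ℂ) ∈ Metric.ball (0 : ℂ) R) :
    AEStronglyMeasurable (fun t : ℝ => F (t + y * Complex.I)) (volume.restrict (uIcc a b)) := by
  rcases eq_or_ne y 0 with rfl | hy
  swap
  · exact hF.aestronglyMeasurable_line_of_ne hy hs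
  -- On the axis itself, F is an almost everywhere limit of its continuous restrictions to nearby
  -- horizontal lines.
  obtain ⟨δ, hδ, hδs⟩ := Metric.eventually_nhds_iff.1 (eventually_uIcc_mem hs)
  obtain ⟨u, -, hu0, hu⟩ := exists_seq_strictAnti_tendsto' hδ
  have hpos : ∀ n, u n ≠ 0 := fun n => (hu0 n).1.ne'
  refine aestronglyMeasurable_of_tendsto_ae atTop (f := fun n (t : ℝ) => F (t + u n * Complex.I))
    (fun n => hF.aestronglyMeasurable_line_of_ne (hpos n) (hδs ?_)) ?_
  · rw [Real.dist_eq, sub_zero, abs_of_pos (hu0 n).1]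
    exact (hu0 n).2
  · rw [ae_restrict_iff' measurableSet_uIcc]
    filter_upwards [hF.ae_continuousAt 0] with x hx hxs
    exact (hx (hs x hxs)).comp hu

theorem intervalIntegrable_line (hF : IsGluedAlongReal F R K) {a b y : ℝ}
    (hs : ∀ t ∈ uIcc a b, (t + y * Complex.I : ℂ) ∈ Metric.ball (0 : ℂ) R) :
    IntervalIntegrable (fun t : ℝ => F (t + y * Complex.I)) volume a b := by
  rw [intervalIntegrable_iff]
  refine IntegrableOn.mono_set ?_ uIoc_subset_uIcc
  have : IsFiniteMeasure (volume.restrict (uIcc a b)) := ⟨by simp [uIcc]⟩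
  refine Integrable.of_bound (hF.aestronglyMeasurable_line hs) K ?_
  rw [ae_restrict_iff' measurableSet_uIcc]
  exact Eventually.of_forall fun t ht => hF.norm_le _ (hs t ht)

theorem continuousAt_integral_line (hF : IsGluedAlongReal F R K) {a b y₀ : ℝ}
    (hs : ∀ t ∈ uIcc a b, (t + y₀ * Complex.I : ℂ) ∈ Metric.ball (0 : ℂ) R) :
    ContinuousAt (fun y : ℝ => ∫ t in a..b, F (t + y * Complex.I)) y₀ := by
  refine intervalIntegral.tendsto_integral_filter_of_dominated_convergence (fun _ => K) ?_ ?_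
    intervalIntegrable_const ?_
  · filter_upwards [eventually_uIcc_mem hs] with y hy
    exact (hF.aestronglyMeasurable_line hy).mono_measure
      (Measure.restrict_mono uIoc_subset_uIcc le_rfl)
  · filter_upwards [eventually_uIcc_mem hs] with y hy
    exact Eventually.of_forall fun t ht => hF.norm_le _ (hy t (uIoc_subset_uIcc ht))
  · filter_upwards [hF.ae_continuousAt y₀] with x hx hxs
    exact hx (hs x (uIoc_subset_uIcc hxs))

theorem add_mem_ball {z : ℂ} {h r : ℝ} (hz : z ∈ Metric.ball (0 : ℂ) (R - h)) (hr : |r| ≤ h) :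
    z + r ∈ Metric.ball (0 : ℂ) R := by
  rw [mem_ball_zero_iff] at *
  have := norm_add_le z (r : ℂ)
  rw [Complex.norm_real, Real.norm_eq_abs] at this
  linarith

theorem line_mem_ball {z : ℂ} {h t : ℝ} (hz : z ∈ Metric.ball (0 : ℂ) (R - h))
    (ht : |t - z.re| ≤ h) : (t + z.im * Complex.I : ℂ) ∈ Metric.ball (0 : ℂ) R := by
  convert add_mem_ball hz ht using 1
  apply Complex.ext <;> simp

theorem norm_horizontalIntegral_le (hF : IsGluedAlongReal F R K) {h : ℝ} (hh : 0 < h) {z : ℂ}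
    (hz : z ∈ Metric.ball (0 : ℂ) (R - h)) : ‖horizontalIntegral F h z‖ ≤ K * h := by
  rw [horizontalIntegral_eq]
  have := intervalIntegral.norm_integral_le_of_norm_le_const (a := 0) (b := h) (C := K)
    (f := fun t : ℝ => F (z + t)) (fun t ht => hF.norm_le _ (add_mem_ball hz ?_))
  · simpa [abs_of_pos hh] using this
  · rw [uIoc_of_le hh.le] at ht
    rw [abs_of_pos ht.1]
    exact ht.2

/-- Vertical continuity is dominated convergence; moving the endpoints horizontally costs at most 2K
|Δ Re z|, uniformly in the height. -/
theorem continuousOn_horizontalIntegral (hF : IsGluedAlongReal F R K) {h : ℝ} (hh : 0 < h) :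
    ContinuousOn (horizontalIntegral F h) (Metric.ball 0 (R - 2 * h)) := by
  intro z₀ hz₀
  refine ContinuousAt.continuousWithinAt ?_
  have hball : ∀ {z : ℂ}, z ∈ Metric.ball (0 : ℂ) (R - 2 * h) → ∀ {t : ℝ}, |t - z.re| ≤ 2 * h →
      (t + z.im * Complex.I : ℂ) ∈ Metric.ball (0 : ℂ) R := fun hz _ ht => line_mem_ball hz ht
  have h1 : ContinuousAt (fun z : ℂ => ∫ t in z₀.re..(z₀.re + h), F (t + z.im * Complex.I)) z₀ := by
    refine ContinuousAt.comp (f := Complex.im)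
      (g := fun y : ℝ => ∫ t in z₀.re..(z₀.re + h), F (t + y * Complex.I))
      (hF.continuousAt_integral_line fun t ht => hball hz₀ ?_) Complex.continuous_im.continuousAt
    rw [uIcc_of_le (by linarith)] at ht
    rw [abs_le]; constructor <;> linarith [ht.1, ht.2]
  have h2 : Tendsto (fun z => horizontalIntegral F h z -
      ∫ t in z₀.re..(z₀.re + h), F (t + z.im * Complex.I)) (𝓝 z₀) (𝓝 0) := by
    have h3 : Tendsto (fun z : ℂ => 2 * K * |z.re - z₀.re|) (𝓝 z₀) (𝓝 0) := by
      have : Continuous fun z : ℂ => 2 * K * |z.re - z₀.re| := by fun_prop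
      simpa using this.tendsto z₀
    refine squeeze_zero_norm' ?_ h3
    have hn : ∀ᶠ z : ℂ in 𝓝 z₀, |z.re - z₀.re| < h := by
      have : Continuous fun z : ℂ => |z.re - z₀.re| := by fun_prop
      exact (this.tendsto z₀).eventually_lt_const (by simpa using hh)
    filter_upwards [Metric.isOpen_ball.mem_nhds hz₀, hn] with z hz hzh
    rw [abs_lt] at hzh
    -- This window contains both intervals of integration once |Re z - Re z₀| < h; its reach of 2h
    -- explains the radius R - 2h.
    have hmem : ∀ t : ℝ, t ∈ Icc (z.re - h) (z.re + 2 * h) →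
        (t + z.im * Complex.I : ℂ) ∈ Metric.ball (0 : ℂ) R := fun t ht => hball hz (by
      rw [abs_le]; constructor <;> linarith [ht.1, ht.2])
    have hsub : ∀ {a b : ℝ}, a ∈ Icc (z.re - h) (z.re + 2 * h) →
        b ∈ Icc (z.re - h) (z.re + 2 * h) → ∀ t ∈ uIcc a b,
        (t + z.im * Complex.I : ℂ) ∈ Metric.ball (0 : ℂ) R := fun ha hb t ht =>
      hmem t ((ordConnected_Icc (a := z.re - h) (b := z.re + 2 * h)).uIcc_subset ha hb ht)
    have m1 : z.re ∈ Icc (z.re - h) (z.re + 2 * h) := ⟨by linarith, by linarith⟩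
    have m2 : z.re + h ∈ Icc (z.re - h) (z.re + 2 * h) := ⟨by linarith, by linarith⟩
    have m3 : z₀.re ∈ Icc (z.re - h) (z.re + 2 * h) := ⟨by linarith, by linarith⟩
    have m4 : z₀.re + h ∈ Icc (z.re - h) (z.re + 2 * h) := ⟨by linarith, by linarith⟩
    have hii : ∀ {a b : ℝ}, a ∈ Icc (z.re - h) (z.re + 2 * h) →
        b ∈ Icc (z.re - h) (z.re + 2 * h) →
        IntervalIntegrable (fun t : ℝ => F (t + z.im * Complex.I)) volume a b :=
      fun ha hb => hF.intervalIntegrable_line (hsub ha hb)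
    have hle : ∀ {a b : ℝ}, a ∈ Icc (z.re - h) (z.re + 2 * h) →
        b ∈ Icc (z.re - h) (z.re + 2 * h) →
        ‖∫ t in a..b, F (t + z.im * Complex.I)‖ ≤ K * |b - a| := fun ha hb =>
      intervalIntegral.norm_integral_le_of_norm_le_const fun t ht =>
        hF.norm_le _ (hsub ha hb t (uIoc_subset_uIcc ht))
    rw [horizontalIntegral, intervalIntegral.integral_interval_sub_interval_comm (hii m1 m2)
      (hii m3 m4) (hii m1 m3)]
    refine (norm_sub_le _ _).trans ?_
    have e1 := hle m1 m3
    have e2 := hle m2 m4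
    rw [show z₀.re + h - (z.re + h) = z₀.re - z.re by ring] at e2
    rw [abs_sub_comm z.re]
    linarith
  have h4 := h2.add h1
  simp only [sub_add_cancel, zero_add] at h4
  exact h4

theorem differentiableAt_horizontalIntegral (hF : IsGluedAlongReal F R K) {h : ℝ} (hh : 0 < h)
    {z₀ : ℂ} (hz₀ : z₀ ∈ Metric.ball (0 : ℂ) (R - h)) (him : z₀.im ≠ 0) :
    DifferentiableAt ℂ (horizontalIntegral F h) z₀ := by
  have him' : 0 < |z₀.im| := abs_pos.2 him
  -- With this ρ, discs of radius ρ about z + t, for z within ρ of z₀, avoid the axis and stay in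
  -- the ball, so Cauchy's estimate gives the dominating constant K / ρ.
  obtain ⟨ρ, hρ, hρ1, hρ2⟩ : ∃ ρ > 0, 2 * ρ < |z₀.im| ∧ ‖z₀‖ + 2 * ρ < R - h := by
    rw [mem_ball_zero_iff] at hz₀
    refine ⟨min |z₀.im| (R - h - ‖z₀‖) / 3, ?_, ?_, ?_⟩
    · have : 0 < min |z₀.im| (R - h - ‖z₀‖) := lt_min him' (by linarith)
      positivity
    · linarith [min_le_left |z₀.im| (R - h - ‖z₀‖)]
    · linarith [min_le_right |z₀.im| (R - h - ‖z₀‖)]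
  set V : Set ℂ := Metric.ball 0 R ∩ {z | z.im ≠ 0} with hV
  have hVo : IsOpen V := Metric.isOpen_ball.inter (isOpen_ne_fun Complex.continuous_im (by fun_prop))
  have hdV : DifferentiableOn ℂ F V := fun z hz =>
    (hF.differentiableAt z hz.1 hz.2).differentiableWithinAt
  have hmem : ∀ {z : ℂ}, z ∈ Metric.closedBall z₀ (2 * ρ) → ∀ {t : ℝ}, t ∈ Icc 0 h →
      z + t ∈ V := by
    intro z hz t ht
    rw [Metric.mem_closedBall, dist_eq_norm] at hz
    refine ⟨add_mem_ball (h := h) ?_ (by rw [abs_of_nonneg ht.1]; exact ht.2), ?_⟩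
    · rw [mem_ball_zero_iff]
      have := norm_sub_norm_le z z₀
      linarith
    · have h1 : |(z - z₀).im| ≤ 2 * ρ := (Complex.abs_im_le_norm _).trans hz
      intro h0
      simp only [Complex.add_im, Complex.ofReal_im, add_zero] at h0
      rw [Complex.sub_im, h0, zero_sub, abs_neg] at h1
      linarith
  have hcont : ∀ {z : ℂ}, z ∈ Metric.closedBall z₀ (2 * ρ) → ∀ {f : ℂ → ℂ}, ContinuousOn f V →
      ContinuousOn (fun t : ℝ => f (z + t)) (uIcc 0 h) := fun hz f hf =>
    hf.comp (by fun_prop) fun t ht => hmem hz (by rwa [uIcc_of_le hh.le] at ht)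
  have hsm : Metric.ball z₀ ρ ⊆ Metric.closedBall z₀ (2 * ρ) :=
    Metric.ball_subset_closedBall.trans (Metric.closedBall_subset_closedBall (by linarith))
  have hself : z₀ ∈ Metric.closedBall z₀ (2 * ρ) := hsm (Metric.mem_ball_self hρ)
  have hIoc : ∀ {t : ℝ}, t ∈ uIoc 0 h → t ∈ Icc 0 h := fun ht => by
    rw [uIoc_of_le hh.le] at ht
    exact Ioc_subset_Icc_self ht
  have key := intervalIntegral.hasDerivAt_integral_of_dominated_loc_of_deriv_le (μ := volume)
    (𝕜 := ℂ) (a := 0) (b := h) (F := fun z t => F (z + t)) (F' := fun z t => deriv F (z + t))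
    (x₀ := z₀) (s := Metric.ball z₀ ρ) (bound := fun _ => K / ρ)
    (Metric.ball_mem_nhds _ hρ) ?_ (hcont hself hdV.continuousOn).intervalIntegrable ?_ ?_
    intervalIntegrable_const ?_
  · have h2 : horizontalIntegral F h = fun z => ∫ t in (0 : ℝ)..h, F (z + t) :=
      funext (horizontalIntegral_eq F h)
    rw [h2]
    exact key.2.differentiableAt
  · filter_upwards [Metric.ball_mem_nhds z₀ hρ] with z hz
    exact ((hcont (hsm hz) hdV.continuousOn).mono uIoc_subset_uIcc).aestronglyMeasurable
      measurableSet_uIoc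
  · exact ((hcont hself (hdV.deriv hVo).continuousOn).mono uIoc_subset_uIcc).aestronglyMeasurable
      measurableSet_uIoc
  · refine Eventually.of_forall fun t ht z hz => ?_
    have hsub : Metric.closedBall (z + t : ℂ) ρ ⊆ V := by
      intro u hu
      rw [← sub_add_cancel u (t : ℂ)]
      refine hmem ?_ (hIoc ht)
      rw [Metric.mem_closedBall, dist_eq_norm] at *
      rw [Metric.mem_ball, dist_eq_norm] at hz
      calc ‖u - t - z₀‖ = ‖(u - (z + t)) + (z - z₀)‖ := by ring_nf
        _ ≤ ‖u - (z + t)‖ + ‖z - z₀‖ := norm_add_le _ _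
        _ ≤ 2 * ρ := by linarith
    exact Complex.norm_deriv_le_of_forall_mem_sphere_norm_le hρ
      (hdV.mono (Metric.closure_ball_subset_closedBall.trans hsub)).diffContOnCl
      fun u hu => hF.norm_le u (hsub (Metric.sphere_subset_closedBall hu)).1
  · refine Eventually.of_forall fun t ht z hz => ?_
    have h3 := hmem (hsm hz) (hIoc ht)
    exact (hF.differentiableAt _ h3.1 h3.2).hasDerivAt.comp_add_const z (t : ℂ)

theorem tendsto_horizontalIntegral (hF : IsGluedAlongReal F R K) {z : ℂ}
    (hz : z ∈ Metric.ball (0 : ℂ) R) (him : z.im ≠ 0) :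
    Tendsto (fun h : ℝ => (h : ℂ)⁻¹ * horizontalIntegral F h z) (𝓝[>] 0) (𝓝 (F z)) := by
  have hc : ContinuousOn (fun t : ℝ => F (z + t)) {t : ℝ | z + t ∈ Metric.ball (0 : ℂ) R} := by
    intro t ht
    have h1 : ContinuousAt F (z + t) := (hF.differentiableAt _ ht (by simpa using him)).continuousAt
    exact (ContinuousAt.comp (f := fun t : ℝ => (z + t : ℂ)) h1
      (Continuous.continuousAt (by fun_prop))).continuousWithinAt
  have ho : IsOpen {t : ℝ | z + t ∈ Metric.ball (0 : ℂ) R} :=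
    Metric.isOpen_ball.preimage (by fun_prop)
  have h0 : (0 : ℝ) ∈ {t : ℝ | z + t ∈ Metric.ball (0 : ℂ) R} := by simpa using hz
  have hd := intervalIntegral.integral_hasDerivAt_right (a := (0 : ℝ)) (b := 0)
    (f := fun t : ℝ => F (z + t)) (by simp)
    (hc.stronglyMeasurableAtFilter ho 0 h0) (hc.continuousAt (ho.mem_nhds h0))
  have hs := hd.tendsto_slope_zero_right
  simp only [zero_add, intervalIntegral.integral_same, sub_zero, Complex.ofReal_zero,
    add_zero] at hs
  refine hs.congr fun h => ?_
  rw [horizontalIntegral_eq, Complex.real_smul, Complex.ofReal_inv]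

/-- **Removal of the real axis**: `F` is Lipschitz off the real axis near `0`. -/
theorem norm_sub_le (hF : IsGluedAlongReal F R K) (hR : 0 < R) {z w : ℂ}
    (hz : z ∈ Metric.ball (0 : ℂ) (R / 4)) (hw : w ∈ Metric.ball (0 : ℂ) (R / 4))
    (hz0 : z.im ≠ 0) (hw0 : w.im ≠ 0) : ‖F z - F w‖ ≤ K / (R / 8) * ‖z - w‖ := by
  have hsub : Metric.ball (0 : ℂ) (R / 4) ⊆ Metric.ball (0 : ℂ) R :=
    Metric.ball_subset_ball (by linarith)
  -- The Lipschitz constant of the averages does not depend on h, so it survives the limit h → 0.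
  refine le_of_tendsto (((hF.tendsto_horizontalIntegral (hsub hz) hz0).sub
    (hF.tendsto_horizontalIntegral (hsub hw) hw0)).norm) ?_
  filter_upwards [Ioo_mem_nhdsGT (show (0 : ℝ) < R / 4 by positivity)] with h hh
  have hb1 : Metric.ball (0 : ℂ) (R / 2) ⊆ Metric.ball 0 (R - 2 * h) :=
    Metric.ball_subset_ball (by linarith [hh.2])
  have hb2 : Metric.ball (0 : ℂ) (R / 2) ⊆ Metric.ball 0 (R - h) :=
    Metric.ball_subset_ball (by linarith [hh.1, hh.2])
  have hd : DifferentiableOn ℂ (horizontalIntegral F h) (Metric.ball 0 (R / 2)) :=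
    differentiableOn_ball_of_differentiableAt_off_real
      ((hF.continuousOn_horizontalIntegral hh.1).mono hb1)
      fun u hu hu0 => hF.differentiableAt_horizontalIntegral hh.1 (hb2 hu) hu0
  have := norm_sub_le_of_bounded_ball (f := fun u => (h : ℂ)⁻¹ * horizontalIntegral F h u)
    (R := R / 2) (K := K) (by positivity) (hd.const_mul _) (fun u hu => ?_)
    (z := z) (w := w) (by convert hz using 2; ring) (by convert hw using 2; ring)
  · rw [show R / 8 = R / 2 / 4 by ring]
    exact this
  · rw [norm_mul, norm_inv, Complex.norm_real, Real.norm_of_nonneg hh.1.le, inv_mul_le_iff₀ hh.1,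
      mul_comm]
    exact hF.norm_horizontalIntegral_le hh.1 (hb2 hu)

end IsGluedAlongReal

/-! ### Reflection and asymptotic unimodularity -/

/-- The extension of `G` from the upper half plane by reflection in the real axis and in the unit
circle, with the unimodular vertical boundary values (if they exist) on the real axis. -/
def reflect (G : ℂ → ℂ) (z : ℂ) : ℂ :=
  open Classical in
  if 0 < z.im then G z else if z.im < 0 then (starRingEnd ℂ (G (starRingEnd ℂ z)))⁻¹ else
    if h : ∃ w : ℂ, ‖w‖ = 1 ∧ Tendsto (fun y : ℝ => G (z.re + y * Complex.I)) (𝓝[>] 0) (𝓝 w)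
      -- The default 1 keeps the extension unimodular on the whole axis.
      then h.choose else 1

theorem reflect_of_pos {G : ℂ → ℂ} {z : ℂ} (hz : 0 < z.im) : reflect G z = G z := by
  simp [reflect, hz]

theorem reflect_of_neg {G : ℂ → ℂ} {z : ℂ} (hz : z.im < 0) :
    reflect G z = (starRingEnd ℂ (G (starRingEnd ℂ z)))⁻¹ := by
  simp [reflect, hz, hz.le]

theorem reflect_ofReal {G : ℂ → ℂ} {x : ℝ}
    (h : ∃ w : ℂ, ‖w‖ = 1 ∧ Tendsto (fun y : ℝ => G (x + y * Complex.I)) (𝓝[>] 0) (𝓝 w)) :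
    ‖reflect G x‖ = 1 ∧
      Tendsto (fun y : ℝ => G (x + y * Complex.I)) (𝓝[>] 0) (𝓝 (reflect G x)) := by
  have : reflect G x = h.choose := by simp [reflect, h]
  rw [this]
  exact h.choose_spec

theorem norm_reflect_of_im_eq_zero {G : ℂ → ℂ} {z : ℂ} (hz : z.im = 0) : ‖reflect G z‖ = 1 := by
  by_cases h : ∃ w : ℂ, ‖w‖ = 1 ∧
      Tendsto (fun y : ℝ => G (z.re + y * Complex.I)) (𝓝[>] 0) (𝓝 w)
  · have hzr : ((z.re : ℝ) : ℂ) = z := by apply Complex.ext <;> simp [hz]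
    have := (reflect_ofReal h).1
    rwa [hzr] at this
  · simp [reflect, hz, h]

/-- The lower bound c keeps the reflected function holomorphic and bounded by c⁻¹. The limits from
both sides agree because 1 / conj w = w for unimodular w. -/
theorem isGluedAlongReal_reflect {G : ℂ → ℂ} {R c C : ℝ} (hc : 0 < c)
    (hd : ∀ z ∈ Metric.ball (0 : ℂ) R, 0 < z.im → DifferentiableAt ℂ G z)
    (hl : ∀ z ∈ Metric.ball (0 : ℂ) R, 0 < z.im → c ≤ ‖G z‖)
    (hu : ∀ z ∈ Metric.ball (0 : ℂ) R, 0 < z.im → ‖G z‖ ≤ C)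
    (hb : ∀ᵐ x : ℝ, (x : ℂ) ∈ Metric.ball (0 : ℂ) R → ∃ w : ℂ, ‖w‖ = 1 ∧
      Tendsto (fun y : ℝ => G (x + y * Complex.I)) (𝓝[>] 0) (𝓝 w)) :
    IsGluedAlongReal (reflect G) R (max (max C c⁻¹) 1) := by
  have hconj : ∀ z ∈ Metric.ball (0 : ℂ) R, starRingEnd ℂ z ∈ Metric.ball (0 : ℂ) R := by
    intro z hz
    rw [mem_ball_zero_iff] at *
    rwa [Complex.norm_conj]
  have him : ∀ {z : ℂ}, z.im < 0 → 0 < (starRingEnd ℂ z).im := fun h => by simpa using h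
  refine ⟨fun z hz hz0 => ?_, fun z hz => ?_, ?_⟩
  · rcases lt_or_gt_of_ne hz0 with h | h
    · have h1 : reflect G =ᶠ[𝓝 z] fun u => (starRingEnd ℂ (G (starRingEnd ℂ u)))⁻¹ := by
        filter_upwards [(isOpen_lt Complex.continuous_im continuous_const).mem_nhds h] with u hu
        exact reflect_of_neg hu
      rw [h1.differentiableAt_iff]
      have h2 := (hd _ (hconj z hz) (him h)).conj_conj
      rw [Complex.conj_conj] at h2
      refine DifferentiableAt.inv h2 ?_
      have := hl _ (hconj z hz) (him h)
      simp only [ne_eq, map_eq_zero]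
      exact norm_pos_iff.1 (hc.trans_le this)
    · have h1 : reflect G =ᶠ[𝓝 z] G := by
        filter_upwards [(isOpen_lt continuous_const Complex.continuous_im).mem_nhds h] with u hu
        exact reflect_of_pos hu
      rw [h1.differentiableAt_iff]
      exact hd z hz h
  · rcases lt_trichotomy z.im 0 with h | h | h
    · rw [reflect_of_neg h, norm_inv, Complex.norm_conj]
      refine le_max_of_le_left (le_max_of_le_right ?_)
      exact inv_anti₀ hc (hl _ (hconj z hz) (him h))
    · rw [norm_reflect_of_im_eq_zero h]
      exact le_max_right _ _
    · rw [reflect_of_pos h]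
      exact le_max_of_le_left (le_max_of_le_left (hu z hz h))
  · filter_upwards [hb] with x hx hxR
    obtain ⟨hn, ht⟩ := reflect_ofReal (hx hxR)
    rw [← Iio_union_Ioi, nhdsWithin_union, tendsto_sup]
    constructor
    · have hne : reflect G x ≠ 0 := norm_pos_iff.1 (by rw [hn]; exact one_pos)
      have hself : (starRingEnd ℂ (reflect G x))⁻¹ = reflect G x := by
        rw [inv_eq_iff_eq_inv]
        exact (RCLike.inv_eq_conj hn).symm
      have hneg : Tendsto (fun y : ℝ => -y) (𝓝[<] 0) (𝓝[>] 0) := by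
        simpa using tendsto_neg_nhdsLT (a := (0 : ℝ))
      have h1 := ((Complex.continuous_conj.tendsto _).comp (ht.comp hneg)).inv₀
        (by simpa using hne)
      rw [hself] at h1
      refine h1.congr' ?_
      filter_upwards [self_mem_nhdsWithin] with y hy
      rw [reflect_of_neg (by simpa using hy)]
      simp
    · refine ht.congr' ?_
      filter_upwards [self_mem_nhdsWithin] with y hy
      rw [reflect_of_pos (by simpa using hy)]

/-- A bounded holomorphic function in the upper half of a disc that is bounded away from zero and
has unimodular boundary values almost everywhere on the diameter is asymptotically unimodular. -/
theorem tendsto_norm_of_unimodular_boundary {G : ℂ → ℂ} {R c C : ℝ} (hR : 0 < R) (hc : 0 < c)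
    (hd : ∀ z ∈ Metric.ball (0 : ℂ) R, 0 < z.im → DifferentiableAt ℂ G z)
    (hl : ∀ z ∈ Metric.ball (0 : ℂ) R, 0 < z.im → c ≤ ‖G z‖)
    (hu : ∀ z ∈ Metric.ball (0 : ℂ) R, 0 < z.im → ‖G z‖ ≤ C)
    (hb : ∀ᵐ x : ℝ, (x : ℂ) ∈ Metric.ball (0 : ℂ) R → ∃ w : ℂ, ‖w‖ = 1 ∧
      Tendsto (fun y : ℝ => G (x + y * Complex.I)) (𝓝[>] 0) (𝓝 w)) :
    Tendsto (fun z => ‖G z‖) (𝓝[{z | 0 < z.im}] 0) (𝓝 1) := by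
  have hF := isGluedAlongReal_reflect hc hd hl hu hb
  set K := max (max C c⁻¹) 1
  have hK : 0 < K := lt_max_of_lt_right one_pos
  rw [tendsto_iff_norm_sub_tendsto_zero]
  have hlim : Tendsto (fun z : ℂ => K * (K / (R / 8) * (2 * |z.im|))) (𝓝[{z | 0 < z.im}] 0)
      (𝓝 0) := by
    have : Continuous fun z : ℂ => K * (K / (R / 8) * (2 * |z.im|)) := by fun_prop
    simpa using (this.tendsto 0).mono_left nhdsWithin_le_nhds
  refine squeeze_zero' (Eventually.of_forall fun _ => norm_nonneg _) ?_ hlim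
  filter_upwards [self_mem_nhdsWithin, mem_nhdsWithin_of_mem_nhds
    (Metric.ball_mem_nhds (0 : ℂ) (show 0 < R / 4 by positivity))] with z hz hzb
  have hz' : 0 < z.im := hz
  have hzR : z ∈ Metric.ball (0 : ℂ) R := Metric.ball_subset_ball (by linarith) hzb
  have hcb : starRingEnd ℂ z ∈ Metric.ball (0 : ℂ) (R / 4) := by
    rw [mem_ball_zero_iff] at *
    rwa [Complex.norm_conj]
  have h1 := hF.norm_sub_le hR hzb hcb hz'.ne' (by simpa using hz'.ne')
  rw [reflect_of_pos hz', reflect_of_neg (by simpa using hz'), Complex.conj_conj] at h1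
  have h2 : ‖z - starRingEnd ℂ z‖ = 2 * |z.im| := by
    rw [Complex.sub_conj]
    simp
  rw [h2] at h1
  have hpos : 0 < ‖G z‖ := hc.trans_le (hl z hzR hz')
  have h3 : ‖G z‖ - ‖G z‖⁻¹ ≤ ‖G z - (starRingEnd ℂ (G z))⁻¹‖ := by
    have := norm_sub_norm_le (G z) (starRingEnd ℂ (G z))⁻¹
    rwa [norm_inv, Complex.norm_conj] at this
  have h4 : ‖G z‖⁻¹ - ‖G z‖ ≤ ‖G z - (starRingEnd ℂ (G z))⁻¹‖ := by
    have := norm_sub_norm_le (starRingEnd ℂ (G z))⁻¹ (G z)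
    rwa [norm_inv, Complex.norm_conj, norm_sub_rev] at this
  have h5 : |‖G z‖ - ‖G z‖⁻¹| ≤ K / (R / 8) * (2 * |z.im|) :=
    abs_le.2 ⟨by linarith, by linarith⟩
  have h6 : ‖G z‖ ≤ K := (hu z hzR hz').trans ((le_max_left _ _).trans (le_max_left _ _))
  -- Turns smallness of |G| - 1/|G| into smallness of |G| - 1.
  have h7 : |‖G z‖ - 1| * (‖G z‖ + 1) = ‖G z‖ * |‖G z‖ - ‖G z‖⁻¹| := by
    have h8 : (‖G z‖ - 1) * (‖G z‖ + 1) = ‖G z‖ * (‖G z‖ - ‖G z‖⁻¹) := by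
      field_simp
      ring
    have h9 := congrArg abs h8
    rwa [abs_mul, abs_mul, abs_of_pos (show 0 < ‖G z‖ + 1 by linarith), abs_of_pos hpos] at h9
  calc ‖‖G z‖ - 1‖ ≤ |‖G z‖ - 1| * (‖G z‖ + 1) := by
        rw [Real.norm_eq_abs]
        exact le_mul_of_one_le_right (abs_nonneg _) (by linarith)
    _ = ‖G z‖ * |‖G z‖ - ‖G z‖⁻¹| := h7
    _ ≤ K * (K / (R / 8) * (2 * |z.im|)) := by gcongr

/-! ### The exponential covering of the punctured disc -/

theorem norm_cis (t : ℝ) : ‖cis t‖ = 1 := Complex.norm_exp_ofReal_mul_I t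

theorem cis_ne_zero (t : ℝ) : cis t ≠ 0 := Complex.exp_ne_zero _

theorem cis_add (s t : ℝ) : cis (s + t) = cis s * cis t := by
  simp only [cis]
  rw [← Complex.exp_add]
  push_cast
  ring_nf

theorem norm_cis_sub_cis_le (s t : ℝ) : ‖cis s - cis t‖ ≤ |s - t| := by
  have h : cis s - cis t = cis t * (Complex.exp (Complex.I * ((s - t : ℝ) : ℂ)) - 1) := by
    have : cis s = cis t * cis (s - t) := by rw [← cis_add]; ring_nf
    rw [this, cis, cis, mul_comm Complex.I]
    ring
  rw [h, norm_mul, norm_cis, one_mul]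
  exact Real.norm_exp_I_mul_ofReal_sub_one_le

theorem exists_cis_eq {ζ : ℂ} (hζ : ‖ζ‖ = 1) : ∃ t : ℝ, cis t = ζ :=
  ⟨ζ.arg, by simpa [hζ, cis] using Complex.norm_mul_exp_arg_mul_I ζ⟩

/-- The covering of the punctured unit disc by the upper half plane, sending `0` to `cis t`. -/
def discCover (t : ℝ) (w : ℂ) : ℂ := cis t * Complex.exp (w * Complex.I)

theorem norm_discCover (t : ℝ) (w : ℂ) : ‖discCover t w‖ = Real.exp (-w.im) := by
  rw [discCover, norm_mul, norm_cis, one_mul, Complex.norm_exp]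
  simp

theorem discCover_mem_disc {t : ℝ} {w : ℂ} (hw : 0 < w.im) : discCover t w ∈ disc := by
  rw [disc, mem_ball_zero_iff, norm_discCover, Real.exp_lt_one_iff]
  linarith

theorem differentiable_discCover (t : ℝ) : Differentiable ℂ (discCover t) := by
  unfold discCover
  fun_prop

theorem tendsto_discCover (t : ℝ) :
    Tendsto (discCover t) (𝓝[{w | 0 < w.im}] 0) (𝓝[disc] (cis t)) := by
  refine tendsto_nhdsWithin_iff.2 ⟨?_, ?_⟩
  · have := (differentiable_discCover t).continuous.tendsto 0
    simp only [discCover, zero_mul, Complex.exp_zero, mul_one] at this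
    exact this.mono_left nhdsWithin_le_nhds
  · filter_upwards [self_mem_nhdsWithin] with w hw
    exact discCover_mem_disc hw

theorem discCover_add_mul_I (t x y : ℝ) :
    discCover t (x + y * Complex.I) = Real.exp (-y) * cis (t + x) := by
  rw [cis_add, discCover, cis, cis, Complex.ofReal_exp, ← Complex.exp_add, ← Complex.exp_add,
    ← Complex.exp_add]
  congr 1
  push_cast
  linear_combination (y : ℂ) * Complex.I_sq

/-- Vertical lines map to radii, where |ζ - z| = 1 - |z|, so aperture 2 suffices. -/
theorem tendsto_discCover_stolz (t x : ℝ) :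
    Tendsto (fun y : ℝ => discCover t (x + y * Complex.I)) (𝓝[>] 0)
      (𝓝[stolz 2 (cis (t + x))] (cis (t + x))) := by
  refine tendsto_nhdsWithin_iff.2 ⟨?_, ?_⟩
  · have hc : Continuous fun y : ℝ => (Real.exp (-y) : ℂ) * cis (t + x) := by fun_prop
    have := hc.tendsto 0
    simp only [neg_zero, Real.exp_zero, Complex.ofReal_one, one_mul] at this
    simp_rw [discCover_add_mul_I]
    exact this.mono_left nhdsWithin_le_nhds
  · filter_upwards [self_mem_nhdsWithin] with y hy
    have hy' : 0 < y := hy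
    refine ⟨discCover_mem_disc (by simpa using hy'), ?_⟩
    have h1 : Real.exp (-y) < 1 := by
      rw [Real.exp_lt_one_iff]
      linarith
    have h2 : cis (t + x) - Real.exp (-y) * cis (t + x) =
        ((1 - Real.exp (-y) : ℝ) : ℂ) * cis (t + x) := by
      push_cast
      ring
    rw [norm_discCover, discCover_add_mul_I, h2, norm_mul, norm_cis, mul_one, Complex.norm_real,
      Real.norm_of_nonneg (by linarith)]
    simp only [Complex.add_im, Complex.ofReal_im, Complex.mul_im, Complex.ofReal_re, Complex.I_im,
      Complex.I_re]
    ring_nf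
    ring_nf at h1
    linarith

/-- The inverse of `discCover t` near `cis t`. -/
theorem tendsto_log_disc (t : ℝ) :
    Tendsto (fun z : ℂ => -Complex.I * Complex.log (z / cis t)) (𝓝[disc] (cis t))
      (𝓝[{w | 0 < w.im}] 0) := by
  have hne : ∀ᶠ z : ℂ in 𝓝[disc] (cis t), z ≠ 0 :=
    (eventually_ne_nhds (cis_ne_zero t)).filter_mono nhdsWithin_le_nhds
  refine tendsto_nhdsWithin_iff.2 ⟨?_, ?_⟩
  · have hc : ContinuousAt (fun z : ℂ => -Complex.I * Complex.log (z / cis t)) (cis t) := by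
      refine continuousAt_const.mul (ContinuousAt.clog (by fun_prop) ?_)
      rw [div_self (cis_ne_zero t)]
      exact Complex.one_mem_slitPlane
    have := hc.tendsto
    simp only [div_self (cis_ne_zero t), Complex.log_one, mul_zero] at this
    exact this.mono_left nhdsWithin_le_nhds
  · filter_upwards [self_mem_nhdsWithin, hne] with z hz hz0
    rw [disc, mem_ball_zero_iff] at hz
    have h1 : (Complex.log (z / cis t)).re < 0 := by
      rw [Complex.log_re, norm_div, norm_cis, div_one]
      exact Real.log_neg (norm_pos_iff.2 hz0) hz
    simpa using h1

theorem discCover_log {t : ℝ} {z : ℂ} (hz : z ≠ 0) :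
    discCover t (-Complex.I * Complex.log (z / cis t)) = z := by
  have h : -Complex.I * Complex.log (z / cis t) * Complex.I = Complex.log (z / cis t) := by
    linear_combination (-Complex.log (z / cis t)) * Complex.I_sq
  rw [discCover, h, Complex.exp_log (div_ne_zero hz (cis_ne_zero t)),
    mul_div_cancel₀ _ (cis_ne_zero t)]

/-! ### Inner functions near the circle, off the spectrum -/

theorem exists_eventually_le_norm {Θ : ℂ → ℂ} {ζ : ℂ} (hζ : ζ ∈ closedDisc)
    (hs : ζ ∉ spectrum Θ) : ∃ c : ℝ, 0 < c ∧ ∀ᶠ z in 𝓝[disc] ζ, c ≤ ‖Θ z‖ := by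
  have hl : 0 < liminf (fun z => ‖Θ z‖ₑ) (𝓝[disc] ζ) :=
    pos_iff_ne_zero.2 fun h => hs ⟨hζ, h⟩
  obtain ⟨a, ha0, ha⟩ := exists_between hl
  have hat : a ≠ ⊤ := ne_top_of_lt ha
  refine ⟨a.toReal, ENNReal.toReal_pos ha0.ne' hat, ?_⟩
  filter_upwards [eventually_lt_of_lt_liminf ha] with z hz
  rw [← toReal_enorm]
  exact ENNReal.toReal_mono enorm_ne_top hz.le

/-- An inner function is asymptotically unimodular at the points of the circle outside its
spectrum. -/
theorem IsInner.tendsto_norm {Θ : ℂ → ℂ} (hΘ : IsInner Θ) {ζ : ℂ} (hζ : ζ ∈ circle)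
    (hs : ζ ∉ spectrum Θ) : Tendsto (fun z => ‖Θ z‖) (𝓝[disc] ζ) (𝓝 1) := by
  obtain ⟨c, hc, hcz⟩ := exists_eventually_le_norm (Metric.sphere_subset_closedBall hζ) hs
  obtain ⟨t, rfl⟩ := exists_cis_eq (mem_sphere_zero_iff_norm.1 hζ)
  obtain ⟨C, hC⟩ := hΘ.bounded
  obtain ⟨R, hR, hRc⟩ := Metric.mem_nhdsWithin_iff.1 ((tendsto_discCover t).eventually hcz)
  have hb : ∀ᵐ x : ℝ, ∃ w : ℂ, ‖w‖ = 1 ∧ HasNontangentialLimit Θ (cis (t + x)) w :=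
    (measurePreserving_add_left volume t).quasiMeasurePreserving.ae hΘ.unimodular
  have key := tendsto_norm_of_unimodular_boundary (G := fun w => Θ (discCover t w)) (C := C) hR hc
    (fun z _ hz => DifferentiableAt.comp z
      (hΘ.analytic _ (discCover_mem_disc hz)).differentiableAt (differentiable_discCover t z))
    (fun z hz hz0 => hRc ⟨hz, hz0⟩) (fun z _ hz => hC _ (discCover_mem_disc hz)) (by
      filter_upwards [hb] with x hx _
      obtain ⟨w, hw, hwl⟩ := hx
      exact ⟨w, hw, (hwl 2).comp (tendsto_discCover_stolz t x)⟩)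
  refine (key.comp (tendsto_log_disc t)).congr' ?_
  filter_upwards [(eventually_ne_nhds (cis_ne_zero t)).filter_mono nhdsWithin_le_nhds] with z hz
  simp only [Function.comp_apply, discCover_log hz]

/-- Points of the level set `{|Θ| < ε}` near the circle are near the boundary spectrum. -/
theorem IsInner.exists_levelSet_disjoint {Θ : ℂ → ℂ} (hΘ : IsInner Θ) {ε : ℝ} (hε : ε < 1)
    {K : Set ℂ} (hK : IsCompact K) (hKc : K ⊆ circle) (hKs : Disjoint K (spectrum Θ)) :
    ∃ δ : ℝ, 0 < δ ∧ ∀ z ∈ levelSet Θ ε, z ∉ Metric.thickening δ K := by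
  have hev : ∀ᶠ z in 𝓝ˢ K, z ∈ disc → ε ≤ ‖Θ z‖ := by
    rw [eventually_nhdsSet_iff_forall]
    intro ζ hζ
    have := (hΘ.tendsto_norm (hKc hζ) (hKs.notMem_of_mem_left hζ)).eventually_const_le hε
    rwa [eventually_nhdsWithin_iff] at this
  obtain ⟨U, hU, hKU, hUs⟩ := eventually_nhdsSet_iff_exists.1 hev
  obtain ⟨δ, hδ, hsub⟩ := hK.exists_thickening_subset_open hU hKU
  exact ⟨δ, hδ, fun z hz hzK => not_lt.2 (hUs z (hsub hzK) hz.1) hz.2⟩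

/-! ### Carleson squares and the conclusion -/

theorem Arc.length_pos (I : Arc) : 0 < I.length := sub_pos.2 I.left_lt_right

/-- The angle is taken from the interval defining the arc, since the φ of the square is only
determined modulo 2π. -/
theorem Arc.exists_angle_of_mem_square {I : Arc} {z : ℂ} (hz : z ∈ I.square) :
    ∃ θ ∈ Icc I.left I.right, ‖z - cis θ‖ ≤ I.length ∧ ‖z‖ ≤ 1 := by
  obtain ⟨ρ, φ, rfl, ⟨θ, hθ, hθφ⟩, hρ, hρ1⟩ := hz
  have hl := I.length_pos
  have hpi := Real.pi_gt_three
  have h1 : I.length / (2 * Real.pi) ≤ 1 := by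
    rw [div_le_one (by positivity), Arc.length]
    linarith [I.right_le]
  have h2 : I.length / (2 * Real.pi) ≤ I.length := div_le_self hl.le (by linarith)
  refine ⟨θ, I.subset_Icc hθ, ?_, ?_⟩
  · have h3 : (ρ : ℂ) * cis φ - cis θ = ((ρ - 1 : ℝ) : ℂ) * cis φ := by
      rw [hθφ]
      push_cast
      ring
    rw [h3, norm_mul, norm_cis, mul_one, Complex.norm_real, Real.norm_eq_abs, abs_le]
    constructor <;> linarith
  · rw [norm_mul, norm_cis, mul_one, Complex.norm_real, Real.norm_eq_abs, abs_le]
    constructor <;> linarith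

/-- Carleson squares over short arcs that meet the level set `{|Θ| < ε}` lie near the boundary
spectrum. -/
theorem IsInner.exists_square_subset_boundaryNhd {Θ : ℂ → ℂ} (hΘ : IsInner Θ) {ε : ℝ}
    (hε : ε < 1) {δ₀ : ℝ} (hδ₀ : 0 < δ₀) :
    ∃ δ : ℝ, 0 < δ ∧ ∀ I : Arc, I.length < δ → (I.square ∩ levelSet Θ ε).Nonempty →
      I.square ⊆ boundaryNhd Θ δ₀ := by
  set E := Metric.thickening (δ₀ / 2) (spectrum Θ ∩ circle) with hE
  have hK : IsCompact (circle \ E) := (isCompact_sphere 0 1).diff Metric.isOpen_thickening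
  obtain ⟨δ, hδ, hlev⟩ := hΘ.exists_levelSet_disjoint hε hK sdiff_subset (by
    rw [Set.disjoint_left]
    intro ζ hζ hζs
    exact hζ.2 (Metric.self_subset_thickening (by positivity) _ ⟨hζs, hζ.1⟩))
  -- Distance budget from a point of the square to the spectrum: δ₀/4 to the arc, δ₀/4 along it,
  -- δ₀/2 from there. If the boundary spectrum is empty, so is E, and no such square meets the level
  -- set.
  refine ⟨min δ (δ₀ / 4), lt_min hδ (by positivity), fun I hI hne => ?_⟩
  obtain ⟨z, hzI, hzl⟩ := hne
  obtain ⟨θ, hθ, hzθ, -⟩ := Arc.exists_angle_of_mem_square hzI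
  have hθE : cis θ ∈ E := by
    by_contra hcon
    refine hlev z hzl (Metric.mem_thickening_iff.2 ⟨cis θ, ⟨?_, hcon⟩, ?_⟩)
    · exact mem_sphere_zero_iff_norm.2 (norm_cis θ)
    · rw [dist_eq_norm]
      exact hzθ.trans_lt (hI.trans_le (min_le_left _ _))
  obtain ⟨σ, hσ, hθσ⟩ := Metric.mem_thickening_iff.1 hθE
  intro w hw
  obtain ⟨τ, hτ, hwτ, hw1⟩ := Arc.exists_angle_of_mem_square hw
  refine ⟨by simpa [closedDisc] using hw1, Metric.mem_thickening_iff.2 ⟨σ, hσ, ?_⟩⟩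
  have h1 : ‖cis τ - cis θ‖ ≤ I.length := (norm_cis_sub_cis_le τ θ).trans (by
    rw [Arc.length, abs_le]
    constructor <;> linarith [hτ.1, hτ.2, hθ.1, hθ.2])
  have h2 := hI.trans_le (min_le_right δ (δ₀ / 4))
  rw [← dist_eq_norm] at h1 hwτ
  linarith [dist_triangle4 w (cis τ) (cis θ) σ]

theorem measure_square_div_le_carlesonConstant (ν : Measure ℂ) (I : Arc) :
    ν I.square / ENNReal.ofReal I.length ≤ carlesonConstant ν :=
  le_sInf fun _ hM => ENNReal.div_le_of_le_mul (hM I)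

end VanishingCarleson

end

theorem proposition4p1 (Θ : ℂ → ℂ) (hΘ : VanishingCarleson.IsInner Θ)
    (μ : MeasureTheory.Measure ℂ) (hμ : μ (VanishingCarleson.closedDisc)ᶜ = 0)
    (hV1 : VanishingCarleson.V1 Θ μ) :
    ∀ ε : ℝ, 0 < ε → ε < 1 → VanishingCarleson.V2 Θ μ ε := by
  intro ε _ hε η hη
  obtain ⟨δ₀, hlt, hδ₀⟩ := ((hV1.eventually_lt_const (ENNReal.ofReal_pos.2 hη)).and
    self_mem_nhdsWithin).exists
  obtain ⟨δ, hδ, hsub⟩ := hΘ.exists_square_subset_boundaryNhd hε hδ₀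
  refine ⟨δ, hδ, fun I hI hne => ?_⟩
  rw [← MeasureTheory.Measure.restrict_eq_self μ (hsub I hI hne)]
  exact (VanishingCarleson.measure_square_div_le_carlesonConstant _ I).trans_lt hlt
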